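/- Let $n\in\mathbb N$, $t_0\in\mathbb R$, and consider the system $\dot x=f(t,x)$, $t\ge t_0$, $x\in\mathbb R^n$, where $f$ is piecewise continuous in $t$ and continuously differentiable in $x$ (meaning: $f(t,\cdot)$ is $C^1$ for every $t\ge t_0$, and $f$ and its Jacobian matrix $\partial f/\partial x$ are jointly continuous in $(t,x)$ away from a set of switching times that is finite in every bounded interval, with one-sided limits, locally uniform in $x$, at those times). Assume forward completeness: for every $s\ge t_0$ and $x\in\mathbb R^n$ there is a solution $t\mapsto\xi(t,s,x)$ on $[s,\infty)$ with $\xi(s,s,x)=x$ (understood as a solution of the integral equation). Let $|\cdot|$ be any norm on $\mathbb R^n$ and let $K\subset\mathbb R^n$ be compact with nonempty interior. For $\varepsilon>0$ and $T\ge0$ let $S(f,t_0,\varepsilon,T,K)$ be the smallest cardinality of a set $E\subset K$ such that for every $\bar x\in K$ there is $x\in E$ with $|\xi(t,t_0,\bar x)-\xi(t,t_0,x)|<\varepsilon$ for all $t\in[t_0,t_0+T]$, and let \[ h(f,t_0,K):=\lim_{\varepsilon\searrow0}\limsup_{T\to\infty}\frac1T\log S(f,t_0,\varepsilon,T,K)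 \] be the topological entropy. Write $\xi(t_1,t_0,K)=\{\xi(t_1,t_0,x):x\in K\}$ and let $\mathrm{co}$ denote the convex hull. For $t_1\ge t_0$ and $i,j\in\{1,\dots,n\}$, $i\ne j$, put \[ m_{ii}(t_1):=\sup_{t\ge t_1}\ \max_{v\in\mathrm{co}(\xi(t_1,t_0,K))}\frac{\partial f_i}{\partial x_i}(t,\xi(t,t_1,v)),\qquad m_{ij}(t_1):=\sup_{t\ge t_1}\ \max_{v\in\mathrm{co}(\xi(t_1,t_0,K))}\Bigl|\frac{\partial f_i}{\partial x_j}(t,\xi(t,t_1,v))\Bigr| . \] Let $\bar A^*=[\bar a^*_{ij}]\in\mathbb R^{n\times n}$ be a Metzler matrix (that is, $\bar a^*_{ij}\ge0$ for $i\ne j$) that bounds the infimum of these suprema over $t_1\ge t_0$, the infimum being taken for all entries together: for every $\delta>0$ there is one $t_1\ge t_0$ such that $m_{ij}(t_1)\le\bar a^*_{ij}+\delta$ for all $i,j\in\{1,\dots,n\}$ (including $i=j$). Then \[ h(f,t_0,K)\le n\max\{\alpha(\bar A^*),0\}, \] where $\alpha(\bar A^*)$ is the largest real part of an eigenvalue of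 $\bar A^*$. -/

import Mathlib

open Set Filter Topology MeasureTheory

noncomputable section

namespace TVEntropy

/-- `g(t, x)` is piecewise continuous in `t ≥ t₀`, jointly with `x`: there are only finitely many
switching times in every bounded interval, `g` is continuous on `[t₀, ∞) × X` away from them, and at
each of them `g` has (locally uniform in `x`) one-sided limits. -/
def PiecewiseContinuousInTime {X F : Type*} [TopologicalSpace X] [TopologicalSpace F]
    (g : ℝ → X → F) (t₀ : ℝ) : Prop :=
  ∃ D : Set ℝ,
    (∀ a b : ℝ, (D ∩ Icc a b).Finite) ∧
    (∀ t ∈ Ici t₀ \ D, ∀ x : X,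
      ContinuousWithinAt (fun q : ℝ × X => g q.1 q.2) (Ici t₀ ×ˢ univ) (t, x)) ∧
    (∀ τ ∈ D, t₀ ≤ τ → ∀ x : X,
      ∃ L : F, Tendsto (fun q : ℝ × X => g q.1 q.2) (𝓝[>] τ ×ˢ 𝓝 x) (𝓝 L)) ∧
    (∀ τ ∈ D, t₀ < τ → ∀ x : X,
      ∃ L : F, Tendsto (fun q : ℝ × X => g q.1 q.2) (𝓝[<] τ ×ˢ 𝓝 x) (𝓝 L))

/-- The regularity of the right-hand side of `ẋ = f(t, x)`, `t ≥ t₀`: piecewise continuous in `t`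
and continuously differentiable in `x`. -/
structure IsRegularField {n : ℕ} (f : ℝ → (Fin n → ℝ) → (Fin n → ℝ)) (t₀ : ℝ) : Prop where
  contDiff : ∀ t, t₀ ≤ t → ContDiff ℝ 1 (f t)
  piecewise : PiecewiseContinuousInTime f t₀
  piecewise_jacobian : PiecewiseContinuousInTime (fun t x => fderiv ℝ (f t) x) t₀

/-- `φ` is a solution of `ẋ = f(t, x)` on `[s, ∞)` with `φ s = x`: it is continuous (hence, by the
integral equation, locally absolutely continuous) and satisfies the integrated equation. -/
structure IsSolution {n : ℕ} (f : ℝ → (Fin n → ℝ) → (Fin n → ℝ)) (s : ℝ) (x : Fin n → ℝ)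
    (φ : ℝ → (Fin n → ℝ)) : Prop where
  continuousOn : ContinuousOn φ (Ici s)
  integrable : ∀ t, s ≤ t → IntervalIntegrable (fun r => f r (φ r)) volume s t
  eq : ∀ t, s ≤ t → φ t = x + ∫ r in s..t, f r (φ r)

/-- Forward completeness: from every time `s ≥ t₀` and every state there is a solution on
`[s, ∞)`. -/
def ForwardComplete {n : ℕ} (f : ℝ → (Fin n → ℝ) → (Fin n → ℝ)) (t₀ : ℝ) : Prop :=
  ∀ s, t₀ ≤ s → ∀ x : Fin n → ℝ, ∃ φ : ℝ → (Fin n → ℝ), IsSolution f s x φ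

open Classical in
/-- `flow f t s x = ξ(t, s, x)`, the solution at time `t ≥ s` with state `x` at time `s`. -/
def flow {n : ℕ} (f : ℝ → (Fin n → ℝ) → (Fin n → ℝ)) (t s : ℝ) (x : Fin n → ℝ) : Fin n → ℝ :=
  if h : ∃ φ : ℝ → (Fin n → ℝ), IsSolution f s x φ then h.choose t else x

/-- The ball `B_{f, t₀}(x, ε, T)` for the norm `p`. -/
def ball {n : ℕ} (p : Seminorm ℝ (Fin n → ℝ)) (f : ℝ → (Fin n → ℝ) → (Fin n → ℝ)) (t₀ : ℝ)
    (x : Fin n → ℝ) (ε T : ℝ) : Set (Fin n → ℝ) :=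
  {y | ∀ t ∈ Icc t₀ (t₀ + T), p (flow f t t₀ y - flow f t t₀ x) < ε}

/-- `E ⊆ K` is a `(T, ε)`-spanning set for `K` at initial time `t₀`. -/
def IsSpanning {n : ℕ} (p : Seminorm ℝ (Fin n → ℝ)) (f : ℝ → (Fin n → ℝ) → (Fin n → ℝ)) (t₀ : ℝ)
    (ε T : ℝ) (K E : Set (Fin n → ℝ)) : Prop :=
  E ⊆ K ∧ K ⊆ ⋃ x ∈ E, ball p f t₀ x ε T

/-- `S(f, t₀, ε, T, K)`, the minimal cardinality of a `(T, ε)`-spanning set. -/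
def spanningNumber {n : ℕ} (p : Seminorm ℝ (Fin n → ℝ)) (f : ℝ → (Fin n → ℝ) → (Fin n → ℝ))
    (t₀ ε T : ℝ) (K : Set (Fin n → ℝ)) : ℕ∞ :=
  ⨅ (E : Set (Fin n → ℝ)) (_ : IsSpanning p f t₀ ε T K E), E.encard

/-- `limsup_{T → ∞} (1 / T) log S(f, t₀, ε, T, K)`. -/
def growthRate {n : ℕ} (p : Seminorm ℝ (Fin n → ℝ)) (f : ℝ → (Fin n → ℝ) → (Fin n → ℝ))
    (t₀ : ℝ) (K : Set (Fin n → ℝ)) (ε : ℝ) : EReal :=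
  limsup (fun T : ℝ => ENNReal.log (spanningNumber p f t₀ ε T K : ENNReal) / (T : EReal)) atTop

/-- The topological entropy `h(f, t₀, K)`: the limit of `growthRate` as `ε ↘ 0`, written as a
supremum because the growth rate is nonincreasing in `ε` (see `tendsto_growthRate`). -/
def entropy {n : ℕ} (p : Seminorm ℝ (Fin n → ℝ)) (f : ℝ → (Fin n → ℝ) → (Fin n → ℝ))
    (t₀ : ℝ) (K : Set (Fin n → ℝ)) : EReal :=
  ⨆ (ε : ℝ) (_ : 0 < ε), growthRate p f t₀ K ε

theorem spanningNumber_antitone {n : ℕ} (p : Seminorm ℝ (Fin n → ℝ))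
    (f : ℝ → (Fin n → ℝ) → (Fin n → ℝ)) (t₀ T : ℝ) (K : Set (Fin n → ℝ)) :
    Antitone fun ε => spanningNumber p f t₀ ε T K := by
  intro ε ε' h
  refine le_iInf₂ fun E hE => iInf₂_le E ⟨hE.1, hE.2.trans ?_⟩
  exact iUnion₂_mono fun x _ y hy t ht => (hy t ht).trans_le h

theorem growthRate_antitone {n : ℕ} (p : Seminorm ℝ (Fin n → ℝ))
    (f : ℝ → (Fin n → ℝ) → (Fin n → ℝ)) (t₀ : ℝ) (K : Set (Fin n → ℝ)) :
    Antitone (growthRate p f t₀ K) := by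
  intro ε ε' h
  refine limsup_le_limsup ?_
  filter_upwards [eventually_gt_atTop 0] with T hT
  refine EReal.div_le_div_right_of_nonneg (by exact_mod_cast hT.le) ?_
  refine ENNReal.log_monotone ?_
  exact_mod_cast spanningNumber_antitone p f t₀ T K h

theorem tendsto_growthRate {n : ℕ} (p : Seminorm ℝ (Fin n → ℝ))
    (f : ℝ → (Fin n → ℝ) → (Fin n → ℝ)) (t₀ : ℝ) (K : Set (Fin n → ℝ)) :
    Tendsto (growthRate p f t₀ K) (𝓝[>] 0) (𝓝 (entropy p f t₀ K)) := by
  have h := (growthRate_antitone p f t₀ K).tendsto_nhdsGT 0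
  rwa [sSup_image] at h

/-- The partial derivative `∂f_i / ∂x_j (t, v)`. -/
def partialDeriv {n : ℕ} (f : ℝ → (Fin n → ℝ) → (Fin n → ℝ)) (t : ℝ) (v : Fin n → ℝ)
    (i j : Fin n) : ℝ :=
  fderiv ℝ (f t) v (Pi.single j 1) i

/-- `∂f_i / ∂x_i (t, v)` on the diagonal and `|∂f_i / ∂x_j (t, v)|` off the diagonal. -/
def compEntry {n : ℕ} (f : ℝ → (Fin n → ℝ) → (Fin n → ℝ)) (t : ℝ) (v : Fin n → ℝ)
    (i j : Fin n) : ℝ :=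
  if i = j then partialDeriv f t v i i else |partialDeriv f t v i j|

/-- The supremum over `t ≥ t₁` and `v ∈ co(ξ(t₁, t₀, K))` of `compEntry` at `(t, ξ(t, t₁, v))`. -/
def supEntry {n : ℕ} (f : ℝ → (Fin n → ℝ) → (Fin n → ℝ)) (t₀ : ℝ) (K : Set (Fin n → ℝ))
    (t₁ : ℝ) (i j : Fin n) : EReal :=
  ⨆ t ∈ Ici t₁, ⨆ v ∈ convexHull ℝ (flow f t₁ t₀ '' K),
    (compEntry f t (flow f t t₁ v) i j : EReal)

/-- A real matrix is Metzler if its off-diagonal entries are nonnegative. -/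
def IsMetzler {n : ℕ} (A : Matrix (Fin n) (Fin n) ℝ) : Prop :=
  ∀ i j : Fin n, i ≠ j → 0 ≤ A i j

/-- The largest real part of a (complex) eigenvalue of `A`. -/
def spectralAbscissa {n : ℕ} (A : Matrix (Fin n) (Fin n) ℝ) : ℝ :=
  sSup (Complex.re '' spectrum ℂ (A.map (fun a : ℝ => (a : ℂ))))

end TVEntropy

end

/-!
Let `r` exceed the spectral abscissa of the Metzler matrix `A`. The solution `u` of
`r u - A u = (1, …, 1)` is positive: this is a minimum principle for large `r`, and persists as `r`
decreases since a nonnegative solution cannot acquire a zero. In the norm `z ↦ max_i |z i| / u i`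
the logarithmic norm of every matrix dominated by `A`, in the sense of `compEntry`, is thus at most
`r`, and a perturbation of `A` by small positive constants keeps this.

After a suitable time `t₁`, the Jacobian along trajectories issued from `co(ξ(t₁, t₀, K))` is such a
matrix. The flow therefore expands weighted distances locally by at most `exp (μ (t - t₁))`, for any
`μ > r`, and then globally by integration along segments of the convex hull. A grid of mesh
proportional to `exp (-μ T)` on the states at time `t₁`, refined by finitely many classes that
control the trajectories on `[t₀, t₁]`, gives spanning sets of size `O(exp (n μ T))` when `μ ≥ 0`.
-/

namespace TVEntropy

section Metzler

open scoped Matrix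

variable {n : ℕ} {A : Matrix (Fin n) (Fin n) ℝ} {r : ℝ}

theorem re_le_spectralAbscissa {z : ℂ} (hz : z ∈ spectrum ℂ (A.map fun a : ℝ => (a : ℂ))) :
    z.re ≤ spectralAbscissa A :=
  le_csSup ((Matrix.finite_spectrum _).image Complex.re).bddAbove ⟨z, hz, rfl⟩

theorem det_scalar_sub_ne_zero_of_spectralAbscissa_lt (hr : spectralAbscissa A < r) :
    (Matrix.scalar (Fin n) r - A).det ≠ 0 := by
  intro hdet
  have hroot : (A.map Complex.ofRealHom).charpoly.IsRoot (r : ℂ) := by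
    rw [Matrix.charpoly_map]
    exact Polynomial.IsRoot.map (by rwa [Polynomial.IsRoot, Matrix.eval_charpoly])
  exact (re_le_spectralAbscissa (Matrix.mem_spectrum_iff_isRoot_charpoly.2 hroot)).not_gt hr

/-- The solution `w` of `r w - A w = (1, …, 1)`, the candidate for a positive strict subsolution of
`A u ≤ r u`. It is meaningful only if `r - A` is invertible, since the inverse of a singular matrix
is `0`. -/
noncomputable def resolventOne (A : Matrix (Fin n) (Fin n) ℝ) (r : ℝ) : Fin n → ℝ :=
  (Matrix.scalar (Fin n) r - A)⁻¹ *ᵥ 1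

theorem mulVec_resolventOne_add_one (hr : spectralAbscissa A < r) :
    A *ᵥ resolventOne A r + 1 = r • resolventOne A r := by
  have hunit := (det_scalar_sub_ne_zero_of_spectralAbscissa_lt hr).isUnit
  have hsolve : (Matrix.scalar (Fin n) r - A) *ᵥ resolventOne A r = 1 := by
    rw [resolventOne, Matrix.mulVec_mulVec, Matrix.mul_nonsing_inv _ hunit, Matrix.one_mulVec]
  rw [← hsolve, Matrix.sub_mulVec, add_sub_cancel]
  ext i
  simp [Matrix.mulVec_diagonal]

theorem mulVec_resolventOne_lt (hr : spectralAbscissa A < r) (i : Fin n) :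
    (A *ᵥ resolventOne A r) i < r * resolventOne A r i := by
  have h := congrFun (mulVec_resolventOne_add_one hr) i
  simp only [Pi.add_apply, Pi.one_apply, Pi.smul_apply, smul_eq_mul] at h
  linarith

theorem continuousOn_resolventOne (A : Matrix (Fin n) (Fin n) ℝ) :
    ContinuousOn (resolventOne A) (Ioi (spectralAbscissa A)) := by
  have hdiag : Continuous fun r : ℝ => fun _ : Fin n => r := by fun_prop
  have hcont : Continuous fun r : ℝ => Matrix.scalar (Fin n) r - A :=
    hdiag.matrix_diagonal.sub continuous_const
  have hcramer : resolventOne A = fun r => (Matrix.scalar (Fin n) r - A).det⁻¹ •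
      (Matrix.scalar (Fin n) r - A).adjugate *ᵥ 1 := by
    ext1 r
    rw [resolventOne, Matrix.inv_def, Matrix.smul_mulVec, Ring.inverse_eq_inv']
  rw [hcramer]
  exact (hcont.matrix_det.continuousOn.inv₀
    fun r hr => det_scalar_sub_ne_zero_of_spectralAbscissa_lt hr).smul
    (hcont.matrix_adjugate.matrix_mulVec continuous_const).continuousOn

theorem IsMetzler.pos_of_nonneg_of_mulVec_lt (hA : IsMetzler A) {w : Fin n → ℝ} (hw : ∀ i, 0 ≤ w i)
    (hlt : ∀ i, (A *ᵥ w) i < r * w i) (i : Fin n) : 0 < w i := by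
  refine lt_of_le_of_ne (hw i) fun hi => ?_
  have hnonneg : 0 ≤ ∑ j, A i j * w j := by
    refine Finset.sum_nonneg fun j _ => ?_
    rcases eq_or_ne i j with rfl | hij
    · simp [← hi]
    · exact mul_nonneg (hA i j hij) (hw j)
  have := hlt i
  rw [← hi, mul_zero] at this
  exact this.not_ge hnonneg

theorem IsMetzler.nonneg_of_mulVec_lt (hA : IsMetzler A) (hr : ∀ i, ∑ j, |A i j| < r)
    {w : Fin n → ℝ} (hlt : ∀ i, (A *ᵥ w) i < r * w i) (i : Fin n) : 0 ≤ w i := by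
  have : Nonempty (Fin n) := ⟨i⟩
  obtain ⟨k, hk⟩ := Finite.exists_min w
  refine le_trans ?_ (hk i)
  by_contra! hneg
  have hrow : (∑ j, |A k j|) * w k ≤ (A *ᵥ w) k := by
    rw [Finset.sum_mul]
    refine Finset.sum_le_sum fun j _ => ?_
    rcases eq_or_ne k j with rfl | hkj
    · exact mul_le_mul_of_nonpos_right (le_abs_self _) hneg.le
    · rw [abs_of_nonneg (hA k j hkj)]
      exact mul_le_mul_of_nonneg_left (hk j) (hA k j hkj)
  exact ((mul_lt_mul_of_neg_right (hr k) hneg).trans_le hrow).not_gt (hlt k)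

theorem exists_forall_sum_abs_lt (A : Matrix (Fin n) (Fin n) ℝ) (a : ℝ) :
    ∃ b, a < b ∧ ∀ i, ∑ j, |A i j| < b := by
  have h := (eventually_gt_atTop a).and
    (eventually_all.2 fun i => eventually_gt_atTop (∑ j, |A i j|))
  exact h.exists

/-- Positivity of `resolventOne A b` for large `b` propagates down to the spectral abscissa: the set
of levels where it holds is open, and closed because a nonnegative solution is positive. -/
theorem IsMetzler.resolventOne_pos (hA : IsMetzler A) (hr : spectralAbscissa A < r) (i : Fin n) :
    0 < resolventOne A r i := by
  set α := spectralAbscissa A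
  set P : Set (Fin n → ℝ) := {w | ∀ i, 0 < w i}
  have hcont := continuousOn_resolventOne A
  have hPopen : IsOpen P := by
    simpa only [P, ofPred_forall] using
      isOpen_iInter_of_finite fun i => isOpen_lt continuous_const (continuous_apply i)
  have hPclosed : closure (Ioi α ∩ resolventOne A ⁻¹' P) ∩ Ioi α ⊆
      Ioi α ∩ resolventOne A ⁻¹' P := by
    rintro r ⟨hcl, hr⟩
    refine ⟨hr, hA.pos_of_nonneg_of_mulVec_lt (fun i => ?_) (mulVec_resolventOne_lt hr)⟩
    have hci : ContinuousWithinAt (fun r => resolventOne A r i)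
        (Ioi α ∩ resolventOne A ⁻¹' P) r :=
      (continuous_apply i).continuousAt.comp_continuousWithinAt
        ((hcont r hr).mono inter_subset_left)
    exact closure_minimal (fun _ => le_of_lt) isClosed_Ici
      (hci.mem_closure (t := Ioi 0) hcl fun _ hx => hx.2 i)
  obtain ⟨b, hb, hbsum⟩ := exists_forall_sum_abs_lt A α
  have hbP : resolventOne A b ∈ P := hA.pos_of_nonneg_of_mulVec_lt
    (hA.nonneg_of_mulVec_lt hbsum (mulVec_resolventOne_lt hb)) (mulVec_resolventOne_lt hb)
  exact (isPreconnected_Ioi.subset_of_closure_inter_subset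
    (hcont.isOpen_inter_preimage isOpen_Ioi hPopen) ⟨b, hb, hb, hbP⟩ hPclosed hr).2 i

theorem IsMetzler.exists_pos_mulVec_lt (hA : IsMetzler A) (hr : spectralAbscissa A < r) :
    ∃ u : Fin n → ℝ, (∀ i, 0 < u i) ∧ ∀ i, (A *ᵥ u) i < r * u i :=
  ⟨resolventOne A r, hA.resolventOne_pos hr, mulVec_resolventOne_lt hr⟩

theorem exists_pos_mulVec_add_const_le {u : Fin n → ℝ} (h : ∀ i, (A *ᵥ u) i < r * u i) :
    ∃ δ > 0, ∀ i, (A.map (· + δ) *ᵥ u) i ≤ r * u i := by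
  have hev : ∀ᶠ δ in 𝓝[>] (0 : ℝ), ∀ i, (A.map (· + δ) *ᵥ u) i ≤ r * u i := by
    refine nhdsWithin_le_nhds (eventually_all.2 fun i => ?_)
    have hcont : Continuous fun δ : ℝ => ∑ j, (A i j + δ) * u j := by fun_prop
    exact (hcont.tendsto' 0 ((A *ᵥ u) i) (by simp [Matrix.mulVec, dotProduct])).eventually_le_const
      (h i)
  exact (eventually_mem_nhdsWithin.and hev).exists

end Metzler

section Calculus

theorem image_le_of_frequently_le {F B : ℝ → ℝ} {a b : ℝ} (hF : ContinuousOn F (Icc a b))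
    (hB : ContinuousOn B (Icc a b)) (ha : F a ≤ B a)
    (hstep : ∀ x ∈ Ico a b, F x = B x → ∃ᶠ y in 𝓝[>] x, F y ≤ B y) :
    ∀ x ∈ Icc a b, F x ≤ B x := by
  suffices Icc a b ⊆ {x | F x ≤ B x} from this
  refine IsClosed.Icc_subset_of_forall_exists_gt ?_ ha ?_
  · rw [inter_comm]
    exact (hF.prodMk hB).preimage_isClosed_of_isClosed isClosed_Icc OrderClosedTopology.isClosed_le'
  · rintro x ⟨hxB, hx⟩ y hy
    have hfreq : ∃ᶠ y in 𝓝[>] x, F y ≤ B y := by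
      rcases (show F x ≤ B x from hxB).eq_or_lt with heq | hlt
      · exact hstep x hx heq
      · have hlt' : ∀ᶠ y in 𝓝[Icc a b] x, F y < B y :=
          (hF x (Ico_subset_Icc_self hx)).eventually_lt (hB x (Ico_subset_Icc_self hx)) hlt
        exact (hlt'.filter_mono (nhdsWithin_le_of_mem (Icc_mem_nhdsGT_of_mem hx))).frequently.mono
          fun _ => le_of_lt
    exact (hfreq.and_eventually (Ioc_mem_nhdsGT hy)).exists

theorem seminorm_sub_le_of_forall_eventually {E F : Type*} [AddCommGroup E] [Module ℝ E]
    [TopologicalSpace E] [IsTopologicalAddGroup E] [ContinuousSMul ℝ E] [AddCommGroup F]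
    [Module ℝ F] {q : Seminorm ℝ E} {p : Seminorm ℝ F} {G : E → F} {C : Set E} {L : ℝ}
    (hC : Convex ℝ C) (hloc : ∀ v ∈ C, ∀ᶠ w in 𝓝 v, p (G w - G v) ≤ L * q (w - v)) {v w : E}
    (hv : v ∈ C) (hw : w ∈ C) : p (G w - G v) ≤ L * q (w - v) := by
  set γ : ℝ →ᵃ[ℝ] E := AffineMap.lineMap v w with hγ
  have hsub (x y : ℝ) : q (γ y - γ x) = |y - x| * q (w - v) := by
    have hdiff : γ y - γ x = (y - x) • (w - v) := by
      simp only [hγ, AffineMap.lineMap_apply_module']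
      module
    rw [hdiff, map_smul_eq_mul, Real.norm_eq_abs]
  have hstep : ∀ x ∈ Icc (0 : ℝ) 1, ∀ᶠ y in 𝓝 x,
      p (G (γ y) - G (γ x)) ≤ |y - x| * (L * q (w - v)) := by
    intro x hx
    filter_upwards [AffineMap.lineMap_continuous.continuousAt.eventually
      (hloc (γ x) (hC.lineMap_mem hv hw hx))] with y hy
    rwa [mul_left_comm, ← hsub]
  have hcont : ContinuousOn (fun y => p (G (γ y) - G v)) (Icc 0 1) := by
    intro x hx
    obtain ⟨ε, hε, hball⟩ := Metric.eventually_nhds_iff.1 (hstep x hx)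
    refine (continuousAt_of_locally_lipschitz hε (L * q (w - v))
      fun y hy => ?_).continuousWithinAt
    rw [Real.dist_eq, Real.dist_eq, mul_comm]
    refine (abs_sub_map_le_sub p _ _).trans ?_
    simpa using hball hy
  have hline := image_le_of_frequently_le (B := fun y => y * (L * q (w - v))) hcont
    (by fun_prop) (by simp [hγ]) fun x hx hxB => ?_
  · simpa [hγ] using hline 1 (right_mem_Icc.2 zero_le_one)
  refine Eventually.frequently ?_
  filter_upwards [nhdsWithin_le_nhds (hstep x (Ico_subset_Icc_self hx)), self_mem_nhdsWithin]
    with y hy hxy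
  rw [abs_of_pos (sub_pos.2 hxy)] at hy
  calc p (G (γ y) - G v) ≤ p (G (γ y) - G (γ x)) + p (G (γ x) - G v) :=
        le_map_sub_add_map_sub p _ _ _
    _ ≤ y * (L * q (w - v)) := by linarith

theorem seminorm_add_integral_le {E : Type*} [NormedAddCommGroup E] [NormedSpace ℝ E]
    [CompleteSpace E] {q : Seminorm ℝ E} (hq : Continuous q) {g : ℝ → E} {x h R : ℝ} (hh : 0 < h)
    (hg : IntervalIntegrable g volume x (x + h)) {d : E}
    (hR : ∀ r ∈ Ioc x (x + h), q (d + h • g r) ≤ R) : q (d + ∫ r in x..(x + h), g r) ≤ R := by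
  have hsmul : IntervalIntegrable (fun r => h • g r) volume x (x + h) := hg.smul h
  have havg : ⨍ r in x..(x + h), (d + h • g r) = d + ∫ r in x..(x + h), g r := by
    rw [interval_average_eq, intervalIntegral.integral_add intervalIntegrable_const hsmul,
      intervalIntegral.integral_const, intervalIntegral.integral_smul, add_sub_cancel_left,
      ← smul_add, inv_smul_smul₀ hh.ne']
  have hconv : Convex ℝ {z | q z ≤ R} := by
    simpa using q.convexOn.convex_le R
  rw [← havg, uIoc_of_le (by linarith)]
  refine hconv.set_average_mem (isClosed_le hq continuous_const) (by simp [hh]) (by simp)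
    ((ae_restrict_mem measurableSet_Ioc).mono hR) (intervalIntegrable_const.add hsmul).1

end Calculus

section PiecewiseContinuous

variable {X F : Type*} {g : ℝ → X → F} {t₀ τ : ℝ} {x : X}

/-- A property of filters of times holds near `τ` if it holds for those along which `g` has a limit:
`𝓝[≥] t₀` at `τ` splits into the left neighbourhoods of `τ`, the point `τ` and the right ones. -/
theorem PiecewiseContinuousInTime.nhdsWithin_induction [TopologicalSpace X] [TopologicalSpace F]
    (hg : PiecewiseContinuousInTime g t₀) (hτ : t₀ ≤ τ) (hc : ContinuousAt (g τ) x)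
    {P : Filter ℝ → Prop}
    (of_tendsto : ∀ l L, Tendsto (fun q : ℝ × X => g q.1 q.2) (l ×ˢ 𝓝 x) (𝓝 L) → P l)
    (sup : ∀ l l', P l → P l' → P (l ⊔ l')) : P (𝓝[Ici t₀] τ) := by
  obtain ⟨D, -, hcont, hright, hleft⟩ := hg
  by_cases hD : τ ∈ D
  · have hsplit : Ici t₀ = Ico t₀ τ ∪ ({τ} ∪ Ioi τ) := by
      rw [singleton_union, Ioi_insert, Ico_union_Ici_eq_Ici hτ]
    rw [hsplit, nhdsWithin_union, nhdsWithin_union, nhdsWithin_singleton]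
    refine sup _ _ ?_ (sup _ _ (of_tendsto _ (g τ x) ?_) ?_)
    · rcases hτ.eq_or_lt with rfl | hlt
      · exact of_tendsto _ (g t₀ x) (by simp)
      · obtain ⟨L, hL⟩ := hleft τ hD hlt x
        exact of_tendsto _ L
          (hL.mono_left (prod_mono_left _ (nhdsWithin_mono _ Ico_subset_Iio_self)))
    · rw [pure_prod, tendsto_map'_iff]
      exact hc
    · obtain ⟨R, hR⟩ := hright τ hD hτ x
      exact of_tendsto _ R hR
  · have hcontx := hcont τ ⟨hτ, hD⟩ x
    rw [ContinuousWithinAt, nhdsWithin_prod_eq, nhdsWithin_univ] at hcontx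
    exact of_tendsto _ _ hcontx

theorem PiecewiseContinuousInTime.eventually_dist_lt [TopologicalSpace X] [PseudoMetricSpace F]
    (hg : PiecewiseContinuousInTime g t₀) (hτ : t₀ ≤ τ) (hc : ContinuousAt (g τ) x) {η : ℝ}
    (hη : 0 < η) :
    ∀ᶠ q : ℝ × X × X in 𝓝[Ici t₀] τ ×ˢ 𝓝 (x, x), dist (g q.1 q.2.1) (g q.1 q.2.2) < η := by
  rw [nhds_prod_eq]
  refine hg.nhdsWithin_induction hτ hc (P := fun l => ∀ᶠ q : ℝ × X × X in l ×ˢ (𝓝 x ×ˢ 𝓝 x),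
    dist (g q.1 q.2.1) (g q.1 q.2.2) < η) (fun l L hL => ?_)
    fun l l' h h' => by rw [sup_prod]; exact eventually_sup.2 ⟨h, h'⟩
  have hfst := hL.comp (tendsto_fst.prodMk (tendsto_fst.comp tendsto_snd) :
    Tendsto (fun q : ℝ × X × X => (q.1, q.2.1)) (l ×ˢ (𝓝 x ×ˢ 𝓝 x)) _)
  have hsnd := hL.comp (tendsto_fst.prodMk (tendsto_snd.comp tendsto_snd) :
    Tendsto (fun q : ℝ × X × X => (q.1, q.2.2)) (l ×ˢ (𝓝 x ×ˢ 𝓝 x)) _)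
  exact (hfst.dist hsnd).eventually_lt_const (by rwa [dist_self])

theorem PiecewiseContinuousInTime.exists_eventually_norm_le [TopologicalSpace X]
    [SeminormedAddCommGroup F] (hg : PiecewiseContinuousInTime g t₀) (hτ : t₀ ≤ τ)
    (hc : ContinuousAt (g τ) x) :
    ∃ M, ∀ᶠ q : ℝ × X in 𝓝[Ici t₀] τ ×ˢ 𝓝 x, ‖g q.1 q.2‖ ≤ M := by
  refine hg.nhdsWithin_induction hτ hc
    (P := fun l => ∃ M, ∀ᶠ q : ℝ × X in l ×ˢ 𝓝 x, ‖g q.1 q.2‖ ≤ M) (fun l L hL => ?_) ?_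
  · exact ⟨‖L‖ + 1, hL.norm.eventually_le_const (lt_add_one _)⟩
  · rintro l l' ⟨M, hM⟩ ⟨M', hM'⟩
    refine ⟨max M M', ?_⟩
    rw [sup_prod]
    exact eventually_sup.2
      ⟨hM.mono fun _ => le_max_of_le_left, hM'.mono fun _ => le_max_of_le_right⟩

variable {I : Set ℝ} {φ : ℝ → X}

theorem PiecewiseContinuousInTime.eventually_forall_dist_lt [PseudoMetricSpace X]
    [PseudoMetricSpace F] (hg : PiecewiseContinuousInTime g t₀)
    (hc : ∀ t, t₀ ≤ t → Continuous (g t)) (hI : IsCompact I) (hIt : I ⊆ Ici t₀)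
    (hφ : ContinuousOn φ I) {η : ℝ} (hη : 0 < η) :
    ∀ᶠ ρ in 𝓝[>] (0 : ℝ), ∀ t ∈ I, ∀ z, dist z (φ t) < ρ → dist (g t z) (g t (φ t)) < η := by
  refine hI.induction_on (p := fun S => ∀ᶠ ρ in 𝓝[>] (0 : ℝ), ∀ t ∈ S, ∀ z,
    dist z (φ t) < ρ → dist (g t z) (g t (φ t)) < η) (by simp)
    (fun S S' hS h => h.mono fun ρ hρ t ht => hρ t (hS ht)) ?_ fun τ hτ => ?_
  · intro S S' h h'
    filter_upwards [h, h'] with ρ hρ hρ' t ht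
    exact ht.elim (hρ t) (hρ' t)
  obtain ⟨U, hU, V, hV, hUV⟩ :=
    eventually_prod_iff.1 (hg.eventually_dist_lt (hIt hτ) (hc τ (hIt hτ)).continuousAt hη)
  obtain ⟨ρ, hρ, hρV⟩ := Metric.eventually_nhds_iff.1 hV
  have hnear : ∀ᶠ t in 𝓝[I] τ, dist (φ t) (φ τ) < ρ / 2 :=
    (hφ τ hτ).eventually (Metric.ball_mem_nhds _ (half_pos hρ))
  refine ⟨_, (hU.filter_mono (nhdsWithin_mono _ hIt)).and hnear, ?_⟩
  filter_upwards [Ioo_mem_nhdsGT (half_pos hρ)] with ρ' hρ' t ht z hz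
  have hzτ : dist z (φ τ) < ρ := by linarith [dist_triangle z (φ t) (φ τ), ht.2, hρ'.2]
  exact hUV ht.1 (y := (z, φ t)) (hρV (by
    rw [Prod.dist_eq]
    exact max_lt hzτ (by linarith [ht.2])))

theorem PiecewiseContinuousInTime.eventually_forall_norm_le [TopologicalSpace X]
    [SeminormedAddCommGroup F] (hg : PiecewiseContinuousInTime g t₀)
    (hc : ∀ t, t₀ ≤ t → Continuous (g t)) (hI : IsCompact I) (hIt : I ⊆ Ici t₀)
    (hφ : ContinuousOn φ I) : ∀ᶠ M : ℝ in atTop, ∀ t ∈ I, ‖g t (φ t)‖ ≤ M := by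
  refine hI.induction_on (p := fun S => ∀ᶠ M : ℝ in atTop, ∀ t ∈ S, ‖g t (φ t)‖ ≤ M) (by simp)
    (fun S S' hS h => h.mono fun M hM t ht => hM t (hS ht)) ?_ fun τ hτ => ?_
  · intro S S' h h'
    filter_upwards [h, h'] with M hM hM' t ht
    exact ht.elim (hM t) (hM' t)
  obtain ⟨M, hM⟩ := hg.exists_eventually_norm_le (hIt hτ) (hc τ (hIt hτ)).continuousAt
  have hcurve : Tendsto (fun t => (t, φ t)) (𝓝[I] τ) (𝓝[Ici t₀] τ ×ˢ 𝓝 (φ τ)) :=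
    Tendsto.prodMk (nhdsWithin_mono _ hIt) (hφ τ hτ)
  refine ⟨_, hcurve.eventually hM, ?_⟩
  filter_upwards [eventually_ge_atTop M] with M' hM' t ht
  exact le_trans ht hM'

end PiecewiseContinuous

section WeightedSup

open scoped Matrix

variable {ι : Type*} [Fintype ι] {u : ι → ℝ}

/-- The weighted sup norm `z ↦ max_i |z i| / u i` attached to a positive vector `u`, with respect to
which the logarithmic norm of a matrix is read off its action on `u`. -/
noncomputable def weightedSup (u : ι → ℝ) : Seminorm ℝ (ι → ℝ) :=
  (normSeminorm ℝ (ι → ℝ)).comp (LinearMap.mulLeft ℝ u⁻¹)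

theorem weightedSup_le_iff (hu : ∀ i, 0 < u i) {z : ι → ℝ} {a : ℝ} (ha : 0 ≤ a) :
    weightedSup u z ≤ a ↔ ∀ i, |z i| ≤ a * u i := by
  have hnorm : weightedSup u z = ‖u⁻¹ * z‖ := rfl
  rw [hnorm, pi_norm_le_iff_of_nonneg ha]
  refine forall_congr' fun i => ?_
  rw [Pi.mul_apply, Pi.inv_apply, norm_mul, norm_inv, Real.norm_of_nonneg (hu i).le,
    Real.norm_eq_abs, inv_mul_le_iff₀ (hu i), mul_comm]

theorem abs_apply_le_weightedSup_mul (hu : ∀ i, 0 < u i) (z : ι → ℝ) (i : ι) :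
    |z i| ≤ weightedSup u z * u i :=
  (weightedSup_le_iff hu (apply_nonneg _ _)).1 le_rfl i

theorem norm_le_mul_weightedSup (hu : ∀ i, 0 < u i) (z : ι → ℝ) : ‖z‖ ≤ ‖u‖ * weightedSup u z := by
  refine (pi_norm_le_iff_of_nonneg (by positivity)).2 fun i => ?_
  calc ‖z i‖ ≤ weightedSup u z * u i := abs_apply_le_weightedSup_mul hu z i
    _ ≤ weightedSup u z * ‖u‖ := by gcongr; exact (le_abs_self _).trans (norm_le_pi_norm u i)
    _ = ‖u‖ * weightedSup u z := mul_comm _ _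

theorem weightedSup_add_smul_mulVec_le (hu : ∀ i, 0 < u i) {A B : Matrix ι ι ℝ} {c h : ℝ}
    (hdiag : ∀ i, B i i ≤ A i i) (hoff : ∀ i j, i ≠ j → |B i j| ≤ A i j)
    (hA : ∀ i, (A *ᵥ u) i ≤ c * u i) (hh : 0 ≤ h) (hB : ∀ i, 0 ≤ 1 + h * B i i)
    (hc : 0 ≤ 1 + h * c) (z : ι → ℝ) :
    weightedSup u (z + h • (B *ᵥ z)) ≤ (1 + h * c) * weightedSup u z := by
  classical
  have hentry (i j : ι) : |(1 + h • B) i j| ≤ (1 + h • A) i j := by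
    rcases eq_or_ne i j with rfl | hij
    · simpa [abs_of_nonneg (hB i)] using mul_le_mul_of_nonneg_left (hdiag i) hh
    · simpa [Matrix.one_apply_ne hij, abs_mul, abs_of_nonneg hh] using
        mul_le_mul_of_nonneg_left (hoff i j hij) hh
  refine (weightedSup_le_iff hu (by positivity)).2 fun i => ?_
  calc |(z + h • (B *ᵥ z)) i| = |∑ j, (1 + h • B) i j * z j| := by
        rw [← Matrix.smul_mulVec, ← Matrix.one_mulVec z, Matrix.mulVec_mulVec, Matrix.mul_one,
          ← Matrix.add_mulVec, Matrix.one_mulVec]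
        rfl
    _ ≤ ∑ j, |(1 + h • B) i j| * |z j| := by
        simpa only [abs_mul] using
          Finset.abs_sum_le_sum_abs (fun j => (1 + h • B) i j * z j) Finset.univ
    _ ≤ ∑ j, (1 + h • A) i j * (weightedSup u z * u j) := by
        gcongr with j
        · exact (abs_nonneg _).trans (hentry i j)
        · exact hentry i j
        · exact abs_apply_le_weightedSup_mul hu z j
    _ = weightedSup u z * (u i + h * (A *ᵥ u) i) := by
        simp_rw [mul_left_comm _ (weightedSup u z), ← Finset.mul_sum]
        congr 1
        change ((1 + h • A) *ᵥ u) i = _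
        simp [Matrix.add_mulVec, Matrix.smul_mulVec]
    _ ≤ weightedSup u z * (u i + h * (c * u i)) := by gcongr; exact hA i
    _ = (1 + h * c) * weightedSup u z * u i := by ring

theorem eventually_weightedSup_add_smul_apply_le [DecidableEq ι] (hu : ∀ i, 0 < u i)
    {A : Matrix ι ι ℝ} {c : ℝ} (hA : ∀ i, (A *ᵥ u) i ≤ c * u i) (M : ℝ) :
    ∀ᶠ h in 𝓝[>] (0 : ℝ), ∀ J : (ι → ℝ) →L[ℝ] (ι → ℝ), ‖J‖ ≤ M →
      (∀ i, J (Pi.single i 1) i ≤ A i i) → (∀ i j, i ≠ j → |J (Pi.single j 1) i| ≤ A i j) →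
      ∀ z, weightedSup u (z + h • J z) ≤ (1 + h * c) * weightedSup u z := by
  have hsmall (a : ℝ) : ∀ᶠ h in 𝓝[>] (0 : ℝ), 0 < 1 + h * a :=
    nhdsWithin_le_nhds (((by fun_prop : Continuous fun h : ℝ => 1 + h * a).tendsto' 0 1
      (by simp)).eventually_const_lt one_pos)
  filter_upwards [self_mem_nhdsWithin, hsmall c, hsmall (-M)] with h (hh : 0 < h) hc hM
    J hJ hdiag hoff z
  have hentry (i : ι) : |J (Pi.single i 1) i| ≤ M := by
    calc |J (Pi.single i 1) i| ≤ ‖J (Pi.single i 1)‖ := norm_le_pi_norm (J (Pi.single i 1)) i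
      _ ≤ M * ‖(Pi.single i 1 : ι → ℝ)‖ := J.le_of_opNorm_le hJ _
      _ = M := by rw [Pi.norm_single, norm_one, mul_one]
  have hmulVec : LinearMap.toMatrix' (J : (ι → ℝ) →ₗ[ℝ] (ι → ℝ)) *ᵥ z = J z :=
    LinearMap.toMatrix'_mulVec _ _
  rw [← hmulVec]
  refine weightedSup_add_smul_mulVec_le hu (fun i => ?_) (fun i j hij => ?_) hA hh.le
    (fun i => ?_) hc.le z
  · simpa [LinearMap.toMatrix'_apply] using hdiag i
  · simpa [LinearMap.toMatrix'_apply] using hoff i j hij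
  · have := mul_le_mul_of_nonneg_left (neg_le_of_abs_le (hentry i)) hh.le
    simp only [LinearMap.toMatrix'_apply, ContinuousLinearMap.coe_coe]
    linarith

end WeightedSup

theorem continuous_seminorm {E : Type*} [NormedAddCommGroup E] [NormedSpace ℝ E]
    [FiniteDimensional ℝ E] (q : Seminorm ℝ E) : Continuous q :=
  continuousOn_univ.1 (q.convexOn.continuousOn isOpen_univ)

section GrowthEstimate

variable {E : Type*} [NormedAddCommGroup E] [NormedSpace ℝ E] {q : Seminorm ℝ E} {d g : ℝ → E}

theorem seminorm_le_mul_exp_of_frequently [CompleteSpace E] (hq : Continuous q) {s T β μ : ℝ}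
    (hd : ContinuousOn d (Icc s T)) (hg : ∀ t ∈ Icc s T, IntervalIntegrable g volume s t)
    (hdg : ∀ t ∈ Icc s T, d t = d s + ∫ r in s..t, g r) (hβ : q (d s) ≤ β)
    (hstep : ∀ x ∈ Ico s T, q (d x) = β * Real.exp (μ * (x - s)) →
      ∃ᶠ h in 𝓝[>] 0, ∀ r ∈ Ioc x (x + h), q (d x + h • g r) ≤ (1 + h * μ) * q (d x)) :
    ∀ t ∈ Icc s T, q (d t) ≤ β * Real.exp (μ * (t - s)) := by
  refine image_le_of_frequently_le (hq.comp_continuousOn hd) (by fun_prop) (by simpa using hβ)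
    fun x hx hxB => ?_
  have hshift : Tendsto (fun h => x + h) (𝓝[>] 0) (𝓝[>] x) :=
    tendsto_nhdsWithin_iff.2 ⟨((continuous_const_add x).tendsto' 0 x (add_zero x)).mono_left
      nhdsWithin_le_nhds, eventually_mem_nhdsWithin.mono fun h => lt_add_of_pos_right x⟩
  refine hshift.frequently ?_
  have hsmall : ∀ᶠ h in 𝓝[>] (0 : ℝ), 0 < h ∧ x + h ∈ Icc s T :=
    eventually_mem_nhdsWithin.and (hshift (Icc_mem_nhdsGT_of_mem hx))
  refine ((hstep x hx hxB).and_eventually hsmall).mono fun h ⟨hbound, hh, hxh⟩ => ?_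
  have hgx := hg x (Ico_subset_Icc_self hx)
  have hgh : IntervalIntegrable g volume x (x + h) := hgx.symm.trans (hg _ hxh)
  calc q (d (x + h)) = q (d x + ∫ r in x..(x + h), g r) := by
        rw [hdg _ hxh, hdg x (Ico_subset_Icc_self hx), add_assoc,
          intervalIntegral.integral_add_adjacent_intervals hgx hgh]
    _ ≤ (1 + h * μ) * q (d x) := seminorm_add_integral_le hq hh hgh hbound
    _ ≤ Real.exp (h * μ) * q (d x) := by
        gcongr
        rw [add_comm]
        exact Real.add_one_le_exp _
    _ = β * Real.exp (μ * (x + h - s)) := by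
        rw [show q (d x) = _ from hxB, mul_left_comm, ← Real.exp_add]
        ring_nf

theorem eventually_seminorm_sub_apply_le {J : ℝ → E →L[ℝ] E} {x C L M η ε : ℝ}
    (hC : ∀ z, ‖z‖ ≤ C * q z) (hL0 : 0 ≤ L) (hL : ∀ z, q z ≤ L * ‖z‖) (hη0 : 0 ≤ η)
    (hη : L * η * C < ε) (hd : ContinuousWithinAt d (Ioi x) x) (hpos : 0 < q (d x))
    (hJ : ∀ᶠ r in 𝓝[>] x, ‖J r‖ ≤ M) (hrem : ∀ᶠ r in 𝓝[>] x, ‖g r - J r (d r)‖ ≤ η * ‖d r‖) :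
    ∀ᶠ r in 𝓝[>] x, q (g r - J r (d x)) ≤ ε * q (d x) := by
  have hlim : Tendsto (fun r => L * (η * ‖d r‖ + M * ‖d r - d x‖)) (𝓝[>] x)
      (𝓝 (L * (η * ‖d x‖ + M * ‖d x - d x‖))) :=
    ((hd.norm.const_mul η).add ((hd.sub_const (d x)).norm.const_mul M)).const_mul L
  have hlt : L * (η * ‖d x‖ + M * ‖d x - d x‖) < ε * q (d x) := by
    calc L * (η * ‖d x‖ + M * ‖d x - d x‖) ≤ L * (η * (C * q (d x))) := by
          rw [sub_self, norm_zero, mul_zero, add_zero]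
          gcongr
          exact hC _
      _ = L * η * C * q (d x) := by ring
      _ < ε * q (d x) := by gcongr
  filter_upwards [hlim.eventually_le_const hlt, hJ, hrem] with r hr hJr hremr
  calc q (g r - J r (d x)) ≤ L * ‖g r - J r (d x)‖ := hL _
    _ = L * ‖(g r - J r (d r)) + J r (d r - d x)‖ := by rw [map_sub, sub_add_sub_cancel]
    _ ≤ L * (η * ‖d r‖ + M * ‖d r - d x‖) := by
        gcongr
        exact norm_add_le_of_le hremr ((J r).le_of_opNorm_le hJr _)
    _ ≤ ε * q (d x) := hr

theorem eventually_forall_mem_Ioc_add {P : ℝ → Prop} {x : ℝ} (hP : ∀ᶠ r in 𝓝[>] x, P r) :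
    ∀ᶠ h in 𝓝[>] (0 : ℝ), ∀ r ∈ Ioc x (x + h), P r := by
  obtain ⟨y, hy, hPy⟩ := mem_nhdsGT_iff_exists_Ioc_subset.1 hP
  filter_upwards [Ioc_mem_nhdsGT (sub_pos.2 hy)] with h hh r hr
  exact hPy ⟨hr.1, by linarith [hr.2, hh.2]⟩

/-- The usual logarithmic norm estimate `q (d t) ≤ q (d s) * exp (μ (t - s))`; the bound `β > 0` in
place of `q (d s)` keeps the barrier positive, which absorbs the remainder of the linearization. -/
theorem seminorm_le_mul_exp_of_logNorm_le [CompleteSpace E] {J : ℝ → E →L[ℝ] E}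
    {s T C L M β η ρ c μ : ℝ} (hd : ContinuousOn d (Icc s T))
    (hg : ∀ t ∈ Icc s T, IntervalIntegrable g volume s t)
    (hdg : ∀ t ∈ Icc s T, d t = d s + ∫ r in s..t, g r)
    (hC : ∀ z, ‖z‖ ≤ C * q z) (hL0 : 0 ≤ L) (hL : ∀ z, q z ≤ L * ‖z‖) (hη0 : 0 ≤ η)
    (hη : L * η * C < μ - c) (hJ : ∀ r ∈ Icc s T, ‖J r‖ ≤ M)
    (hrem : ∀ r ∈ Icc s T, ‖d r‖ < ρ → ‖g r - J r (d r)‖ ≤ η * ‖d r‖)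
    (hlog : ∀ᶠ h in 𝓝[>] (0 : ℝ), ∀ r ∈ Icc s T, ∀ z, q (z + h • J r z) ≤ (1 + h * c) * q z)
    (hβ : 0 < β) (hβρ : ∀ t ∈ Icc s T, β * (C * Real.exp (μ * (t - s))) < ρ) (hds : q (d s) ≤ β) :
    ∀ t ∈ Icc s T, q (d t) ≤ β * Real.exp (μ * (t - s)) := by
  have hq : Continuous q := Seminorm.continuous_of_le (q := L.toNNReal • normSeminorm ℝ E)
    (continuous_norm.const_smul L.toNNReal) fun z => by
      simpa [NNReal.smul_def, Real.coe_toNNReal L hL0] using hL z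
  refine seminorm_le_mul_exp_of_frequently hq hd hg hdg hds fun x hx hxβ => ?_
  have hxI := Ico_subset_Icc_self hx
  have hmem := Icc_mem_nhdsGT_of_mem hx
  have hdx : ContinuousWithinAt d (Ioi x) x := (hd x hxI).mono_of_mem_nhdsWithin hmem
  have hdρ : ‖d x‖ < ρ := by
    calc ‖d x‖ ≤ C * q (d x) := hC _
      _ = β * (C * Real.exp (μ * (x - s))) := by rw [hxβ, mul_left_comm]
      _ < ρ := hβρ x hxI
  have herr : ∀ᶠ r in 𝓝[>] x, q (g r - J r (d x)) ≤ (μ - c) * q (d x) := by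
    refine eventually_seminorm_sub_apply_le hC hL0 hL hη0 hη hdx (hxβ ▸ by positivity)
      (eventually_of_mem hmem hJ) ?_
    filter_upwards [hmem, hdx.norm.eventually_lt_const hdρ] with r hr hrρ using hrem r hr hrρ
  refine Eventually.frequently ?_
  filter_upwards [hlog, self_mem_nhdsWithin, eventually_forall_mem_Ioc_add (herr.and hmem)]
    with h hh (hh0 : 0 < h) hr r hrx
  obtain ⟨herr, hrI⟩ := hr r hrx
  calc q (d x + h • g r) = q ((d x + h • J r (d x)) + h • (g r - J r (d x))) := by
        congr 1
        module
    _ ≤ (1 + h * c) * q (d x) + h * ((μ - c) * q (d x)) := by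
        refine (map_add_le_add q _ _).trans (add_le_add (hh r hrI _) ?_)
        rw [map_smul_eq_mul, Real.norm_of_nonneg hh0.le]
        gcongr
    _ = (1 + h * μ) * q (d x) := by ring

end GrowthEstimate

theorem eventually_forall_mul_lt {X : Type*} [TopologicalSpace X] {I : Set X} (hI : IsCompact I)
    {k : X → ℝ} (hk : ContinuousOn k I) {ρ : ℝ} (hρ : 0 < ρ) :
    ∀ᶠ β in 𝓝[>] (0 : ℝ), ∀ t ∈ I, β * k t < ρ := by
  obtain ⟨N, hN⟩ := hI.bddAbove_image hk
  have hsmall : ∀ᶠ β in 𝓝[>] (0 : ℝ), β * N < ρ := nhdsWithin_le_nhds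
    (((continuous_mul_const N).tendsto' 0 0 (zero_mul N)).eventually_lt_const hρ)
  filter_upwards [hsmall, self_mem_nhdsWithin] with β hβ (hβ0 : 0 < β) t ht
  exact (mul_le_mul_of_nonneg_left (hN (mem_image_of_mem k ht)) hβ0.le).trans_lt hβ

section Solutions

variable {n : ℕ} {f : ℝ → (Fin n → ℝ) → (Fin n → ℝ)} {t₀ s : ℝ} {v w : Fin n → ℝ}
  {φ ψ : ℝ → (Fin n → ℝ)}

theorem IsRegularField.continuous_fderiv (hf : IsRegularField f t₀) {t : ℝ} (ht : t₀ ≤ t) :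
    Continuous fun x => fderiv ℝ (f t) x :=
  (hf.contDiff t ht).continuous_fderiv one_ne_zero

theorem IsRegularField.eventually_forall_norm_sub_fderiv_le (hf : IsRegularField f t₀) {I : Set ℝ}
    (hI : IsCompact I) (hIt : I ⊆ Ici t₀) (hφ : ContinuousOn φ I) {η : ℝ} (hη : 0 < η) :
    ∀ᶠ ρ in 𝓝[>] (0 : ℝ), ∀ t ∈ I, ∀ z, ‖z - φ t‖ < ρ →
      ‖f t z - f t (φ t) - fderiv ℝ (f t) (φ t) (z - φ t)‖ ≤ η * ‖z - φ t‖ := by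
  filter_upwards [hf.piecewise_jacobian.eventually_forall_dist_lt
    (fun t ht => hf.continuous_fderiv ht) hI hIt hφ hη, self_mem_nhdsWithin] with ρ hρ hρ0 t ht z hz
  exact (convex_ball (φ t) ρ).norm_image_sub_le_of_norm_fderiv_le'
    (fun x _ => (hf.contDiff t (hIt ht)).differentiable one_ne_zero x)
    (fun x hx => by simpa only [dist_eq_norm] using (hρ t ht x hx).le)
    (Metric.mem_ball_self hρ0) (mem_ball_iff_norm.2 hz)

theorem IsSolution.initial (hφ : IsSolution f s v φ) : φ s = v := by
  simpa using hφ.eq s le_rfl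

theorem IsSolution.restart (hφ : IsSolution f s v φ) {s' : ℝ} (hs : s ≤ s') :
    IsSolution f s' (φ s') φ where
  continuousOn := hφ.continuousOn.mono (Ici_subset_Ici.2 hs)
  integrable t ht := (hφ.integrable s' hs).symm.trans (hφ.integrable t (hs.trans ht))
  eq t ht := by
    have hs' := hφ.integrable s' hs
    rw [hφ.eq t (hs.trans ht), hφ.eq s' hs, add_assoc,
      intervalIntegral.integral_add_adjacent_intervals hs'
        (hs'.symm.trans (hφ.integrable t (hs.trans ht)))]

theorem IsSolution.sub_eq_add_integral (hψ : IsSolution f s w ψ) (hφ : IsSolution f s v φ) {t : ℝ}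
    (ht : s ≤ t) :
    ψ t - φ t = (ψ s - φ s) + ∫ r in s..t, (f r (ψ r) - f r (φ r)) := by
  rw [intervalIntegral.integral_sub (hψ.integrable t ht) (hφ.integrable t ht), hψ.eq t ht,
    hφ.eq t ht, hψ.initial, hφ.initial]
  abel

variable {T c μ C : ℝ} {q : Seminorm ℝ (Fin n → ℝ)}

theorem IsSolution.eventually_seminorm_sub_le_of_le (hf : IsRegularField f t₀) (hs : t₀ ≤ s)
    (hφ : IsSolution f s v φ) (hC : ∀ z, ‖z‖ ≤ C * q z) (hcμ : c < μ)
    (hlog : ∀ᶠ h in 𝓝[>] (0 : ℝ), ∀ t ∈ Icc s T, ∀ z,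
      q (z + h • fderiv ℝ (f t) (φ t) z) ≤ (1 + h * c) * q z) :
    ∀ᶠ β in 𝓝[>] (0 : ℝ), ∀ w ψ, IsSolution f s w ψ → q (w - v) ≤ β →
      ∀ t ∈ Icc s T, q (ψ t - φ t) ≤ β * Real.exp (μ * (t - s)) := by
  have hIt : Icc s T ⊆ Ici t₀ := fun t ht => hs.trans ht.1
  have hφI : ContinuousOn φ (Icc s T) := hφ.continuousOn.mono Icc_subset_Ici_self
  obtain ⟨L, hL0, hL⟩ := Seminorm.bound_of_continuous_normedSpace q (continuous_seminorm q)
  obtain ⟨M, hM⟩ := (hf.piecewise_jacobian.eventually_forall_norm_le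
    (fun t ht => hf.continuous_fderiv ht) isCompact_Icc hIt hφI).exists
  obtain ⟨η, hη0, hη⟩ := exists_pos_mul_lt (sub_pos.2 hcμ) (L * C)
  obtain ⟨ρ, hρ0, hρ⟩ := (eventually_mem_nhdsWithin.and
    (hf.eventually_forall_norm_sub_fderiv_le isCompact_Icc hIt hφI hη0)).exists
  have hexp : ContinuousOn (fun t => C * Real.exp (μ * (t - s))) (Icc s T) := by fun_prop
  filter_upwards [eventually_forall_mul_lt isCompact_Icc hexp hρ0, self_mem_nhdsWithin]
    with β hβ hβ0 w ψ hψ hwv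
  exact seminorm_le_mul_exp_of_logNorm_le (d := fun t => ψ t - φ t)
    (J := fun t => fderiv ℝ (f t) (φ t)) ((hψ.continuousOn.mono Icc_subset_Ici_self).sub hφI)
    (fun t ht => (hψ.integrable t ht.1).sub (hφ.integrable t ht.1))
    (fun t ht => hψ.sub_eq_add_integral hφ ht.1) hC hL0.le hL hη0.le (by rwa [mul_right_comm]) hM
    (fun t ht => hρ t ht (ψ t)) hlog hβ0 hβ (by rwa [hψ.initial, hφ.initial])

theorem IsSolution.eventually_seminorm_sub_le (hf : IsRegularField f t₀) (hs : t₀ ≤ s)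
    (hφ : IsSolution f s v φ) (hC : ∀ z, ‖z‖ ≤ C * q z) (hcμ : c < μ)
    (hlog : ∀ᶠ h in 𝓝[>] (0 : ℝ), ∀ t ∈ Icc s T, ∀ z,
      q (z + h • fderiv ℝ (f t) (φ t) z) ≤ (1 + h * c) * q z) :
    ∀ᶠ w in 𝓝 v, ∀ ψ, IsSolution f s w ψ →
      ∀ t ∈ Icc s T, q (ψ t - φ t) ≤ Real.exp (μ * (t - s)) * q (w - v) := by
  obtain ⟨β₀, hβ₀, hβ⟩ := mem_nhdsGT_iff_exists_Ioc_subset.1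
    (hφ.eventually_seminorm_sub_le_of_le hf hs hC hcμ hlog)
  have hnear : ∀ᶠ w in 𝓝 v, q (w - v) < β₀ := by
    have hcont : Continuous fun w => q (w - v) :=
      (continuous_seminorm q).comp (continuous_sub_right v)
    exact (hcont.tendsto' v 0 (by simp)).eventually_lt_const hβ₀
  filter_upwards [hnear] with w hw ψ hψ t ht
  have hlim : Tendsto (fun β => β * Real.exp (μ * (t - s))) (𝓝[>] q (w - v))
      (𝓝 (q (w - v) * Real.exp (μ * (t - s)))) :=
    (tendsto_id.mul_const _).mono_left nhdsWithin_le_nhds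
  rw [mul_comm]
  refine ge_of_tendsto hlim ?_
  filter_upwards [Ioc_mem_nhdsGT hw] with β hβw
  exact hβ ⟨(apply_nonneg q _).trans_lt hβw.1, hβw.2⟩ w ψ hψ hβw.1.le t ht

/-- The crude case of `IsSolution.eventually_seminorm_sub_le`: the logarithmic norm of the Jacobian
is at most its norm. -/
theorem IsSolution.exists_eventually_norm_sub_le (hf : IsRegularField f t₀) (hs : t₀ ≤ s)
    (hφ : IsSolution f s v φ) (T : ℝ) :
    ∃ μ, ∀ᶠ w in 𝓝 v, ∀ ψ, IsSolution f s w ψ →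
      ∀ t ∈ Icc s T, ‖ψ t - φ t‖ ≤ Real.exp (μ * (t - s)) * ‖w - v‖ := by
  have hIt : Icc s T ⊆ Ici t₀ := fun t ht => hs.trans ht.1
  obtain ⟨M, hM⟩ := (hf.piecewise_jacobian.eventually_forall_norm_le
    (fun t ht => hf.continuous_fderiv ht) isCompact_Icc hIt
    (hφ.continuousOn.mono Icc_subset_Ici_self)).exists
  refine ⟨M + 1, hφ.eventually_seminorm_sub_le (q := normSeminorm ℝ (Fin n → ℝ)) (C := 1) hf hs
    (fun z => by simp) (lt_add_one M) ?_⟩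
  filter_upwards [self_mem_nhdsWithin] with h (hh : 0 < h) t ht z
  calc ‖z + h • fderiv ℝ (f t) (φ t) z‖ ≤ ‖z‖ + h * (M * ‖z‖) := by
        refine norm_add_le_of_le le_rfl ?_
        rw [norm_smul, Real.norm_of_nonneg hh.le]
        gcongr
        exact ContinuousLinearMap.le_of_opNorm_le _ (hM t ht) z
    _ = (1 + h * M) * ‖z‖ := by ring

theorem IsSolution.unique (hf : IsRegularField f t₀) (hs : t₀ ≤ s) (hφ : IsSolution f s v φ)
    (hψ : IsSolution f s v ψ) {t : ℝ} (ht : s ≤ t) : ψ t = φ t := by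
  obtain ⟨μ, hμ⟩ := hφ.exists_eventually_norm_sub_le hf hs t
  simpa [sub_eq_zero] using hμ.self_of_nhds ψ hψ t (right_mem_Icc.2 ht)

end Solutions

section Flow

variable {n : ℕ} {f : ℝ → (Fin n → ℝ) → (Fin n → ℝ)} {t₀ s : ℝ}

theorem ForwardComplete.isSolution_flow (hfc : ForwardComplete f t₀) (hs : t₀ ≤ s)
    (x : Fin n → ℝ) : IsSolution f s x fun t => flow f t s x := by
  simpa only [flow, dif_pos (hfc s hs x)] using (hfc s hs x).choose_spec

theorem ForwardComplete.flow_flow (hfc : ForwardComplete f t₀) (hf : IsRegularField f t₀) {t : ℝ}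
    (hs : t₀ ≤ s) (hst : s ≤ t) (x : Fin n → ℝ) :
    flow f t s (flow f s t₀ x) = flow f t t₀ x :=
  ((hfc.isSolution_flow le_rfl x).restart hs).unique hf hs (hfc.isSolution_flow hs _) hst

theorem ForwardComplete.eventually_forall_seminorm_flow_sub_flow_lt (hfc : ForwardComplete f t₀)
    (hf : IsRegularField f t₀) (hs : t₀ ≤ s) (p : Seminorm ℝ (Fin n → ℝ)) {ε : ℝ} (hε : 0 < ε)
    (T : ℝ) (v : Fin n → ℝ) :
    ∀ᶠ w in 𝓝 v, ∀ t ∈ Icc s T, p (flow f t s w - flow f t s v) < ε := by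
  obtain ⟨L, hL0, hL⟩ := Seminorm.bound_of_continuous_normedSpace p (continuous_seminorm p)
  obtain ⟨μ, hμ⟩ := (hfc.isSolution_flow hs v).exists_eventually_norm_sub_le hf hs T
  have hexp : ContinuousOn (fun t => L * Real.exp (μ * (t - s))) (Icc s T) := by fun_prop
  obtain ⟨β, hβ0, hβ⟩ :=
    (eventually_mem_nhdsWithin.and (eventually_forall_mul_lt isCompact_Icc hexp hε)).exists
  filter_upwards [hμ, Metric.ball_mem_nhds v hβ0] with w hw hwv t ht
  calc p (flow f t s w - flow f t s v) ≤ L * (Real.exp (μ * (t - s)) * ‖w - v‖) :=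
        (hL _).trans (by gcongr; exact hw _ (hfc.isSolution_flow hs w) t ht)
    _ ≤ L * (Real.exp (μ * (t - s)) * β) := by
        gcongr
        exact (mem_ball_iff_norm.1 hwv).le
    _ = β * (L * Real.exp (μ * (t - s))) := by ring
    _ < ε := hβ t ht

theorem ForwardComplete.continuous_flow (hfc : ForwardComplete f t₀) (hf : IsRegularField f t₀)
    {t : ℝ} (hs : t₀ ≤ s) (ht : s ≤ t) : Continuous fun x => flow f t s x := by
  refine continuous_iff_continuousAt.2 fun v => Metric.tendsto_nhds.2 fun ε hε => ?_
  filter_upwards [hfc.eventually_forall_seminorm_flow_sub_flow_lt hf hs (normSeminorm ℝ _) hε t v]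
    with w hw
  exact (dist_eq_norm _ _).trans_lt (hw t (right_mem_Icc.2 ht))

open scoped Matrix in
theorem ForwardComplete.weightedSup_flow_sub_flow_le (hfc : ForwardComplete f t₀)
    (hf : IsRegularField f t₀) (hs : t₀ ≤ s) {C : Set (Fin n → ℝ)} (hC : Convex ℝ C)
    {u : Fin n → ℝ} (hu : ∀ i, 0 < u i) {A : Matrix (Fin n) (Fin n) ℝ} {c μ : ℝ} (hcμ : c < μ)
    (hA : ∀ i, (A *ᵥ u) i ≤ c * u i)
    (hcomp : ∀ t, s ≤ t → ∀ v ∈ C, ∀ i j, compEntry f t (flow f t s v) i j ≤ A i j)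
    {v w : Fin n → ℝ} (hv : v ∈ C) (hw : w ∈ C) {t : ℝ} (ht : s ≤ t) :
    weightedSup u (flow f t s w - flow f t s v) ≤
      Real.exp (μ * (t - s)) * weightedSup u (w - v) := by
  refine seminorm_sub_le_of_forall_eventually (G := flow f t s) hC (fun v hv => ?_) hv hw
  have hsol := hfc.isSolution_flow hs v
  obtain ⟨M, hM⟩ := (hf.piecewise_jacobian.eventually_forall_norm_le
    (fun t ht => hf.continuous_fderiv ht) isCompact_Icc (fun r hr => hs.trans hr.1)
    (hsol.continuousOn.mono (Icc_subset_Ici_self : Icc s t ⊆ Ici s))).exists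
  have hlog : ∀ᶠ h in 𝓝[>] (0 : ℝ), ∀ r ∈ Icc s t, ∀ z,
      weightedSup u (z + h • fderiv ℝ (f r) (flow f r s v) z) ≤ (1 + h * c) * weightedSup u z := by
    filter_upwards [eventually_weightedSup_add_smul_apply_le hu hA M] with h hh r hr
    refine hh _ (hM r hr) (fun i => ?_) fun i j hij => ?_
    · simpa [compEntry, partialDeriv] using hcomp r hr.1 v hv i i
    · simpa [compEntry, partialDeriv, hij] using hcomp r hr.1 v hv i j
  filter_upwards [hsol.eventually_seminorm_sub_le hf hs (norm_le_mul_weightedSup hu) hcμ hlog]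
    with w hw
  exact hw _ (hfc.isSolution_flow hs w) t (right_mem_Icc.2 ht)

end Flow

section Counting

theorem exists_finset_int_norm_sub_le (ι : Type*) [Fintype ι] {R ℓ : ℝ} (hR : 0 ≤ R) (hℓ : 0 < ℓ) :
    ∃ (S : Finset (ι → ℤ)) (k : (ι → ℝ) → (ι → ℤ)),
      (S.card : ℝ) ≤ (2 * (R / ℓ) + 3) ^ Fintype.card ι ∧
      (∀ z, ‖z‖ ≤ R → k z ∈ S) ∧ ∀ z z', k z = k z' → ‖z - z'‖ ≤ ℓ := by
  classical
  set m : ℕ := ⌈R / ℓ⌉₊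
  refine ⟨Fintype.piFinset fun _ => Finset.Icc (-(m : ℤ)) m, fun z i => ⌊z i / ℓ⌋, ?_,
    fun z hz => Fintype.mem_piFinset.2 fun i => ?_, fun z z' hzz' => ?_⟩
  · have hside : ((Finset.Icc (-(m : ℤ)) m).card : ℝ) ≤ 2 * (R / ℓ) + 3 := by
      have hcard : (Finset.Icc (-(m : ℤ)) m).card = 2 * m + 1 := by
        rw [Int.card_Icc]
        lia
      have hm : (m : ℝ) < R / ℓ + 1 := Nat.ceil_lt_add_one (by positivity)
      rw [hcard]
      push_cast
      linarith
    rw [Fintype.card_piFinset, Finset.prod_const, Finset.card_univ, Nat.cast_pow]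
    gcongr
  · have hzi : |z i / ℓ| ≤ m := by
      rw [abs_div, abs_of_pos hℓ]
      exact (div_le_div_of_nonneg_right ((norm_le_pi_norm z i).trans hz) hℓ.le).trans
        (Nat.le_ceil _)
    obtain ⟨hlow, hupp⟩ := abs_le.1 hzi
    exact Finset.mem_Icc.2 ⟨Int.le_floor.2 (by exact_mod_cast hlow),
      by exact_mod_cast (Int.floor_le _).trans hupp⟩
  · refine (pi_norm_le_iff_of_nonneg hℓ.le).2 fun i => ?_
    have hlt := Int.abs_sub_lt_one_of_floor_eq_floor (congrFun hzz' i)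
    rw [← sub_div, abs_div, abs_of_pos hℓ, div_lt_one hℓ] at hlt
    exact hlt.le

theorem exists_finset_int_norm_sub_le_div (ι : Type*) [Fintype ι] {R ℓ a : ℝ} (hR : 0 ≤ R)
    (hℓ : 0 < ℓ) (ha : 1 ≤ a) :
    ∃ (S : Finset (ι → ℤ)) (k : (ι → ℝ) → (ι → ℤ)),
      (S.card : ℝ) ≤ (2 * (R / ℓ) + 3) ^ Fintype.card ι * a ^ Fintype.card ι ∧
      (∀ z, ‖z‖ ≤ R → k z ∈ S) ∧ ∀ z z', k z = k z' → ‖z - z'‖ ≤ ℓ / a := by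
  obtain ⟨S, k, hcard, hk⟩ := exists_finset_int_norm_sub_le ι hR (ℓ := ℓ / a) (by positivity)
  refine ⟨S, k, hcard.trans ?_, hk⟩
  rw [← mul_pow, add_mul, div_div_eq_mul_div, mul_assoc, div_mul_eq_mul_div]
  gcongr
  exact le_mul_of_one_le_right zero_le_three ha

variable {n : ℕ} {p : Seminorm ℝ (Fin n → ℝ)} {f : ℝ → (Fin n → ℝ) → (Fin n → ℝ)}
  {t₀ t₁ ε : ℝ} {K : Set (Fin n → ℝ)}

theorem spanningNumber_le_card {ι : Type*} {T : ℝ} (S : Finset ι) (k : (Fin n → ℝ) → ι)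
    (hkS : ∀ x ∈ K, k x ∈ S)
    (hk : ∀ x ∈ K, ∀ y ∈ K, k x = k y → y ∈ ball p f t₀ x ε T) :
    spanningNumber p f t₀ ε T K ≤ S.card := by
  obtain ⟨E, hEK, hE⟩ := exists_subset_bijOn K k
  have hcov : K ⊆ ⋃ x ∈ E, ball p f t₀ x ε T := by
    intro y hy
    obtain ⟨x, hx, hxy⟩ := hE.surjOn (mem_image_of_mem k hy)
    exact mem_iUnion₂.2 ⟨x, hx, hk x (hEK hx) y hy hxy⟩
  refine (iInf₂_le E ⟨hEK, hcov⟩).trans ?_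
  rw [← hE.injOn.encard_image, hE.image_eq, ← encard_coe_eq_coe_finsetCard]
  exact encard_le_encard (image_subset_iff.2 hkS)

theorem ForwardComplete.exists_finset_seminorm_flow_sub_flow_lt (hfc : ForwardComplete f t₀)
    (hf : IsRegularField f t₀) (hK : Bornology.IsBounded K) (p : Seminorm ℝ (Fin n → ℝ)) (t₁ : ℝ)
    (hε : 0 < ε) :
    ∃ (S : Finset (Fin n → ℝ)) (a : (Fin n → ℝ) → (Fin n → ℝ)), (∀ x ∈ K, a x ∈ S) ∧
      ∀ x ∈ K, ∀ y ∈ K, a x = a y → ∀ t ∈ Icc t₀ t₁, p (flow f t t₀ y - flow f t t₀ x) < ε := by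
  obtain ⟨S, -, hS⟩ := hK.isCompact_closure.elim_nhds_subcover
    (fun v => {w | ∀ t ∈ Icc t₀ t₁, p (flow f t t₀ w - flow f t t₀ v) < ε / 2})
    fun v _ => hfc.eventually_forall_seminorm_flow_sub_flow_lt hf le_rfl p (half_pos hε) t₁ v
  have hcenter (x : Fin n → ℝ) : ∃ v, x ∈ K →
      v ∈ S ∧ ∀ t ∈ Icc t₀ t₁, p (flow f t t₀ x - flow f t t₀ v) < ε / 2 := by
    by_cases hx : x ∈ K
    · obtain ⟨v, hv, hxv⟩ := mem_iUnion₂.1 (hS (subset_closure hx))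
      exact ⟨v, fun _ => ⟨hv, hxv⟩⟩
    · exact ⟨x, fun h => absurd h hx⟩
  choose a ha using hcenter
  refine ⟨S, a, fun x hx => (ha x hx).1, fun x hx y hy hxy t ht => ?_⟩
  have hx' := (ha x hx).2 t ht
  have hy' := (ha y hy).2 t ht
  rw [← hxy] at hy'
  calc p (flow f t t₀ y - flow f t t₀ x)
      = p ((flow f t t₀ y - flow f t t₀ (a x)) - (flow f t t₀ x - flow f t t₀ (a x))) := by
        rw [sub_sub_sub_cancel_right]
    _ ≤ p (flow f t t₀ y - flow f t t₀ (a x)) + p (flow f t t₀ x - flow f t t₀ (a x)) :=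
        map_sub_le_add p _ _
    _ < ε := by linarith

theorem ForwardComplete.isBounded_image_flow (hfc : ForwardComplete f t₀)
    (hf : IsRegularField f t₀) (hK : Bornology.IsBounded K) (ht₁ : t₀ ≤ t₁) :
    Bornology.IsBounded (flow f t₁ t₀ '' K) :=
  (hK.isCompact_closure.image (hfc.continuous_flow hf le_rfl ht₁)).isBounded.subset
    (image_mono subset_closure)

theorem ForwardComplete.exists_spanningNumber_le (hfc : ForwardComplete f t₀)
    (hf : IsRegularField f t₀) (hK : Bornology.IsBounded K) (ht₁ : t₀ ≤ t₁) {μ G : ℝ}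
    (hμ : 0 ≤ μ) (hG : 0 < G)
    (hexp : ∀ x ∈ K, ∀ y ∈ K, ∀ t, t₁ ≤ t → p (flow f t t₀ y - flow f t t₀ x) ≤
      G * Real.exp (μ * (t - t₁)) * ‖flow f t₁ t₀ y - flow f t₁ t₀ x‖)
    (hε : 0 < ε) :
    ∃ D : ℝ, ∀ T, 0 ≤ T →
      (spanningNumber p f t₀ ε T K : ENNReal) ≤ ENNReal.ofReal (D * Real.exp (n * μ * T)) := by
  obtain ⟨S, a, haS, ha⟩ := hfc.exists_finset_seminorm_flow_sub_flow_lt hf hK p t₁ hε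
  obtain ⟨R, hR0, hR⟩ := (hfc.isBounded_image_flow hf hK ht₁).exists_pos_norm_le
  refine ⟨S.card * (2 * (R / (ε / (2 * G))) + 3) ^ n, fun T hT => ?_⟩
  obtain ⟨cells, k, hcard, hk, hmesh⟩ := exists_finset_int_norm_sub_le_div (Fin n) hR0.le
    (ℓ := ε / (2 * G)) (by positivity) (Real.one_le_exp (mul_nonneg hμ hT))
  have hspan : spanningNumber p f t₀ ε T K ≤ (S ×ˢ cells).card := by
    refine spanningNumber_le_card (S ×ˢ cells) (fun x => (a x, k (flow f t₁ t₀ x)))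
      (fun x hx => Finset.mk_mem_product (haS x hx) (hk _ (hR _ (mem_image_of_mem _ hx))))
      fun x hx y hy hxy t ht => ?_
    obtain ⟨hclass, hcell⟩ := Prod.mk.inj hxy
    rcases le_total t t₁ with htt₁ | htt₁
    · exact ha x hx y hy hclass t ⟨ht.1, htt₁⟩
    calc p (flow f t t₀ y - flow f t t₀ x)
        ≤ G * Real.exp (μ * (t - t₁)) * ‖flow f t₁ t₀ y - flow f t₁ t₀ x‖ := hexp x hx y hy t htt₁
      _ ≤ G * Real.exp (μ * T) * (ε / (2 * G) / Real.exp (μ * T)) := by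
          gcongr
          · linarith [ht.2]
          · exact hmesh _ _ hcell.symm
      _ = ε / 2 := by field_simp
      _ < ε := half_lt_self hε
  rw [Fintype.card_fin, ← Real.exp_nat_mul, ← mul_assoc] at hcard
  calc (spanningNumber p f t₀ ε T K : ENNReal) ≤ (((S ×ˢ cells).card : ℕ∞) : ENNReal) :=
        ENat.toENNReal_le.2 hspan
    _ = ENNReal.ofReal (S.card * cells.card) := by
        rw [← Nat.cast_mul, ← Finset.card_product, ENNReal.ofReal_natCast, ENat.toENNReal_coe]
    _ ≤ _ := ENNReal.ofReal_le_ofReal (by rw [mul_assoc]; gcongr)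

theorem limsup_log_div_le {N : ℝ → ENNReal} {D c : ℝ}
    (hN : ∀ T, 0 ≤ T → N T ≤ ENNReal.ofReal (D * Real.exp (c * T))) :
    limsup (fun T : ℝ => ENNReal.log (N T) / (T : EReal)) atTop ≤ (c : EReal) := by
  have hlim : Tendsto (fun T : ℝ => D / T + c) atTop (𝓝 c) := by
    simpa only [zero_add, id] using (tendsto_id.const_div_atTop D).add_const c
  rw [← ((continuous_coe_real_ereal.tendsto c).comp hlim).limsup_eq]
  refine limsup_le_limsup ?_
  filter_upwards [eventually_gt_atTop 0] with T hT
  have hlog : ENNReal.log (N T) ≤ ((D + c * T : ℝ) : EReal) := by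
    calc ENNReal.log (N T) ≤ ENNReal.log (ENNReal.ofReal (Real.exp (D + c * T))) := by
          refine ENNReal.log_monotone ((hN T hT.le).trans (ENNReal.ofReal_le_ofReal ?_))
          rw [Real.exp_add]
          gcongr
          linarith [Real.add_one_le_exp D]
      _ = ((D + c * T : ℝ) : EReal) := by
          rw [ENNReal.log_ofReal_of_pos (Real.exp_pos _), Real.log_exp]
  calc ENNReal.log (N T) / (T : EReal) ≤ ((D + c * T : ℝ) : EReal) / (T : EReal) :=
        EReal.div_le_div_right_of_nonneg (by exact_mod_cast hT.le) hlog
    _ = ((D / T + c : ℝ) : EReal) := by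
        rw [← EReal.coe_div, add_div, mul_div_cancel_right₀ c hT.ne']

end Counting

section EntropyBound

open scoped Matrix

variable {n : ℕ} {f : ℝ → (Fin n → ℝ) → (Fin n → ℝ)} {t₀ t₁ : ℝ} {K : Set (Fin n → ℝ)}

theorem compEntry_le_of_supEntry_le {i j : Fin n} {b : ℝ} (h : supEntry f t₀ K t₁ i j ≤ (b : EReal))
    {t : ℝ} (ht : t₁ ≤ t) {v : Fin n → ℝ} (hv : v ∈ convexHull ℝ (flow f t₁ t₀ '' K)) :
    compEntry f t (flow f t t₁ v) i j ≤ b :=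
  EReal.coe_le_coe_iff.1 (iSup₂_le_iff.1 (iSup₂_le_iff.1 h t ht) v hv)

theorem ForwardComplete.exists_seminorm_flow_sub_flow_le (hfc : ForwardComplete f t₀)
    (hf : IsRegularField f t₀) (p : Seminorm ℝ (Fin n → ℝ)) (ht₁ : t₀ ≤ t₁) {u : Fin n → ℝ}
    (hu : ∀ i, 0 < u i) {A : Matrix (Fin n) (Fin n) ℝ} {c μ : ℝ} (hcμ : c < μ)
    (hA : ∀ i, (A *ᵥ u) i ≤ c * u i) (hsup : ∀ i j, supEntry f t₀ K t₁ i j ≤ (A i j : EReal)) :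
    ∃ G > 0, ∀ x ∈ K, ∀ y ∈ K, ∀ t, t₁ ≤ t → p (flow f t t₀ y - flow f t t₀ x) ≤
      G * Real.exp (μ * (t - t₁)) * ‖flow f t₁ t₀ y - flow f t₁ t₀ x‖ := by
  obtain ⟨P, hP0, hP⟩ := Seminorm.bound_of_continuous_normedSpace p (continuous_seminorm p)
  obtain ⟨L, hL0, hL⟩ := Seminorm.bound_of_continuous_normedSpace (weightedSup u)
    (continuous_seminorm _)
  refine ⟨P * (‖u‖ + 1) * L, by positivity, fun x hx y hy t ht => ?_⟩
  have hweighted : weightedSup u (flow f t t₀ y - flow f t t₀ x) ≤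
      Real.exp (μ * (t - t₁)) * weightedSup u (flow f t₁ t₀ y - flow f t₁ t₀ x) := by
    rw [← hfc.flow_flow hf ht₁ ht x, ← hfc.flow_flow hf ht₁ ht y]
    exact hfc.weightedSup_flow_sub_flow_le hf ht₁ (convex_convexHull ℝ (flow f t₁ t₀ '' K)) hu hcμ
      hA (fun t ht v hv i j => compEntry_le_of_supEntry_le (hsup i j) ht hv)
      (subset_convexHull ℝ _ (mem_image_of_mem _ hx))
      (subset_convexHull ℝ _ (mem_image_of_mem _ hy)) ht
  calc p (flow f t t₀ y - flow f t t₀ x) ≤ P * ‖flow f t t₀ y - flow f t t₀ x‖ := hP _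
    _ ≤ P * ((‖u‖ + 1) * weightedSup u (flow f t t₀ y - flow f t t₀ x)) := by
        gcongr
        refine (norm_le_mul_weightedSup hu _).trans ?_
        gcongr
        exact le_add_of_nonneg_right zero_le_one
    _ ≤ P * ((‖u‖ + 1) * (Real.exp (μ * (t - t₁)) *
          (L * ‖flow f t₁ t₀ y - flow f t₁ t₀ x‖))) := by
        gcongr
        exact hweighted.trans (by gcongr; exact hL _)
    _ = P * (‖u‖ + 1) * L * Real.exp (μ * (t - t₁)) * ‖flow f t₁ t₀ y - flow f t₁ t₀ x‖ := by
        ring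

theorem growthRate_le_of_spectralAbscissa_lt (p : Seminorm ℝ (Fin n → ℝ))
    (hf : IsRegularField f t₀) (hfc : ForwardComplete f t₀) (hK : Bornology.IsBounded K)
    {A : Matrix (Fin n) (Fin n) ℝ} (hA : IsMetzler A)
    (hAbound : ∀ δ : ℝ, 0 < δ → ∃ t₁ : ℝ, t₀ ≤ t₁ ∧
      ∀ i j : Fin n, supEntry f t₀ K t₁ i j ≤ ((A i j + δ : ℝ) : EReal))
    {μ : ℝ} (hμ : 0 ≤ μ) (hAμ : spectralAbscissa A < μ) {ε : ℝ} (hε : 0 < ε) :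
    growthRate p f t₀ K ε ≤ ((n * μ : ℝ) : EReal) := by
  obtain ⟨c, hAc, hcμ⟩ := exists_between hAμ
  obtain ⟨u, hu, huA⟩ := hA.exists_pos_mulVec_lt hAc
  obtain ⟨δ, hδ, huδ⟩ := exists_pos_mulVec_add_const_le huA
  obtain ⟨t₁, ht₁, hsup⟩ := hAbound δ hδ
  obtain ⟨G, hG, hexp⟩ := hfc.exists_seminorm_flow_sub_flow_le hf p ht₁ hu hcμ huδ hsup
  obtain ⟨D, hD⟩ := hfc.exists_spanningNumber_le hf hK ht₁ hμ hG hexp hε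
  exact limsup_log_div_le hD

end EntropyBound

end TVEntropy

open TVEntropy in
theorem corollary3_general {n : ℕ} (p : Seminorm ℝ (Fin n → ℝ))
    (f : ℝ → (Fin n → ℝ) → (Fin n → ℝ)) (t₀ : ℝ)
    (hf : IsRegularField f t₀) (hfc : ForwardComplete f t₀)
    (K : Set (Fin n → ℝ)) (hK : Bornology.IsBounded K)
    (A : Matrix (Fin n) (Fin n) ℝ) (hA : IsMetzler A)
    (hAbound : ∀ δ : ℝ, 0 < δ → ∃ t₁ : ℝ, t₀ ≤ t₁ ∧
      ∀ i j : Fin n, supEntry f t₀ K t₁ i j ≤ ((A i j + δ : ℝ) : EReal)) :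
    entropy p f t₀ K ≤ (((n : ℝ) * max (spectralAbscissa A) 0 : ℝ) : EReal) := by
  refine iSup₂_le fun ε hε => ?_
  have hcont : Continuous fun μ : ℝ => ((n * μ : ℝ) : EReal) :=
    continuous_coe_real_ereal.comp (continuous_const_mul _)
  refine ge_of_tendsto ((hcont.tendsto (max (spectralAbscissa A) 0)).mono_left
    (nhdsWithin_le_nhds (s := Ioi (max (spectralAbscissa A) 0)))) ?_
  filter_upwards [self_mem_nhdsWithin] with μ (hμ : max (spectralAbscissa A) 0 < μ)
  obtain ⟨hAμ, hμ0⟩ := max_lt_iff.1 hμ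
  exact growthRate_le_of_spectralAbscissa_lt p hf hfc hK hA hAbound hμ0.le hAμ hε


open TVEntropy in
theorem corollary3 {n : ℕ} (p : Seminorm ℝ (Fin n → ℝ)) (hp : ∀ x, p x = 0 → x = 0)
    (f : ℝ → (Fin n → ℝ) → (Fin n → ℝ)) (t₀ : ℝ)
    (hf : IsRegularField f t₀) (hfc : ForwardComplete f t₀)
    (K : Set (Fin n → ℝ)) (hK : IsCompact K) (hKint : (interior K).Nonempty)
    (A : Matrix (Fin n) (Fin n) ℝ) (hA : IsMetzler A)
    (hAbound : ∀ δ : ℝ, 0 < δ → ∃ t₁ : ℝ, t₀ ≤ t₁ ∧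
      ∀ i j : Fin n, supEntry f t₀ K t₁ i j ≤ ((A i j + δ : ℝ) : EReal)) :
    entropy p f t₀ K ≤ (((n : ℝ) * max (spectralAbscissa A) 0 : ℝ) : EReal) :=
  corollary3_general p f t₀ hf hfc K hK.isBounded A hA hAbound
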